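/- All graphs are finite and simple. For a graph $G$, a Gallai set is a set of vertices of $G$ that meets every longest path of $G$, and $\mathrm{lpt}(G)$ denotes the minimum size of a Gallai set. For a graph $H$, let $\mathrm{Free}(H)$ be the class of graphs with no induced subgraph isomorphic to $H$. The class $\mathrm{Free}(H)$ is called a Gallai family if $\mathrm{lpt}(G) = 1$ for every connected graph $G \in \mathrm{Free}(H)$ (connected graphs being non-empty). A linear forest is a forest in which every component is a path. Proposition 5. Let $H$ be a graph. If $\mathrm{Free}(H)$ is a Gallai family, then $H$ is a linear forest and $|V(H)| \le 9$. -/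

import Mathlib

namespace SimpleGraph

/-- A path of `G` (a walk with no repeated vertex) of maximum length among all paths of `G`. -/
def IsLongestPath {V : Type*} (G : SimpleGraph V) {u v : V} (p : G.Walk u v) : Prop :=
  p.IsPath ∧ ∀ (x y : V) (q : G.Walk x y), q.IsPath → q.length ≤ p.length

/-- A Gallai set (longest path transversal): a set of vertices meeting every longest path. -/
def IsGallaiSet {V : Type*} (G : SimpleGraph V) (S : Set V) : Prop :=
  ∀ (u v : V) (p : G.Walk u v), G.IsLongestPath p → ∃ w ∈ S, w ∈ p.support

/-- The Gallai number `lpt(G)`: the minimum size of a Gallai set. For a finite graph the set of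
sizes is non-empty, since the whole vertex set is a Gallai set. -/
noncomputable def lpt {V : Type*} (G : SimpleGraph V) : ℕ :=
  sInf {n : ℕ | ∃ S : Finset V, G.IsGallaiSet (S : Set V) ∧ S.card = n}

/-- A family of graphs, given by its membership predicate. Every finite graph is isomorphic to one
whose vertex type lives in `Type`. -/
abbrev GraphFamily : Type 1 := (W : Type) → SimpleGraph W → Prop

/-- A family of (finite) graphs is a Gallai family if `lpt(G) = 1` for each connected member `G`.
Connected graphs are non-empty. -/
def IsGallaiFamily (𝒢 : GraphFamily) : Prop :=
  ∀ (W : Type) [Finite W] (G : SimpleGraph W), 𝒢 W G → G.Connected → G.lpt = 1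

/-- `Free(H)`: the class of graphs with no induced subgraph isomorphic to `H`. -/
def FreeClass {V : Type*} (H : SimpleGraph V) : GraphFamily :=
  fun _ G => ¬ H.IsIndContained G

/-- `H` is a fixer if `Free(H)` is a Gallai family. -/
def IsFixer {V : Type*} (H : SimpleGraph V) : Prop := IsGallaiFamily H.FreeClass

/-- A linear forest: a forest in which every component is a path (on `n + 1 ≥ 1` vertices). -/
def IsLinearForest {V : Type*} (H : SimpleGraph V) : Prop :=
  H.IsAcyclic ∧
    ∀ c : H.ConnectedComponent, ∃ n : ℕ, Nonempty (c.toSimpleGraph ≃g pathGraph (n + 1))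

end SimpleGraph

/-! If Free(H) is a Gallai family, then H is an induced subgraph of every finite connected graph
whose longest paths have no common vertex. Two such graphs, both derived from the Petersen graph,
suffice. Cycles of `splitPetersen` have lengths 4 to 9, while those of `inflatedPetersen` are
triangles or have length at least 10, so H has no cycle (`IsFixer.isAcyclic`). Since
`inflatedPetersen` is claw-free, a vertex of the forest H has at most two neighbours
(`IsFixer.eq_of_adj`), which makes H a linear forest. Finally, any ten of the twelve vertices of
`splitPetersen` induce a vertex of degree three, so H has at most nine vertices
(`IsFixer.card_le_nine`). The bounds on path and cycle lengths rest on a verified exhaustive search,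
`explore`. -/

namespace SimpleGraph

/-! ### Finite forests of maximum degree two -/

section LinearForest

variable {V : Type*} {G : SimpleGraph V}

/-- An edge between two vertices of a path of an acyclic graph belongs to that path. -/
lemma IsAcyclic.mem_edges_of_adj (h : G.IsAcyclic) {u v a b : V} {p : G.Walk u v} (hp : p.IsPath)
    (hab : G.Adj a b) (ha : a ∈ p.support) (hb : b ∈ p.support) : s(a, b) ∈ p.edges := by
  classical
  -- Split the path at `a`: in a forest, a neighbour of an end of a path that lies on the path is
  -- next to that end.
  rw [← p.take_spec ha, Walk.mem_support_append_iff] at hb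
  rcases hb with hb | hb
  · have hnil : ¬ (p.takeUntil a ha).Nil := fun hn => by
      rw [Walk.nil_iff_support_eq.mp hn, List.mem_singleton] at hb
      exact hab.ne (hb.trans hn.eq).symm
    have := h.eq_penultimate_of_adj_end (hp.takeUntil ha) hab hb
    have hmem := Walk.mk_penultimate_end_mem_edges hnil
    rw [← this, Sym2.eq_swap] at hmem
    exact p.edges_takeUntil_subset_edges ha hmem
  · have hnil : ¬ (p.dropUntil a ha).Nil := fun hn => by
      rw [Walk.nil_iff_support_eq.mp hn, List.mem_singleton] at hb
      exact hab.ne hb.symm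
    have := h.eq_snd_of_adj_start (hp.dropUntil ha) hab hb
    have hmem := Walk.mk_start_snd_mem_edges hnil
    rw [← this] at hmem
    exact p.edges_dropUntil_subset_edges ha hmem

/-- In a connected graph without three distinct neighbours at a common vertex, a longest path
visits every vertex. -/
lemma Connected.mem_support_of_isLongestPath (hG : G.Connected)
    (hdeg : ∀ v a b c, G.Adj v a → G.Adj v b → G.Adj v c → a = b ∨ a = c ∨ b = c)
    {u v : V} {p : G.Walk u v} (hp : G.IsLongestPath p) (w : V) : w ∈ p.support := by
  classical
  by_contra hw
  obtain ⟨q⟩ := hG.preconnected u w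
  -- Some edge `xy` leaves the path. If `x` is an end, the path extends to `y`; otherwise `x` has
  -- three neighbours.
  obtain ⟨⟨⟨x, y⟩, hxy⟩, -, hx, hy⟩ :=
    q.exists_boundary_dart {z | z ∈ p.support} p.start_mem_support hw
  simp only [Set.mem_ofPred_eq] at hx hy hxy
  obtain ⟨i, rfl, hi⟩ := Walk.mem_support_iff_exists_getVert.mp hx
  have hmem (j : ℕ) : p.getVert j ≠ y := fun h => hy (h ▸ p.getVert_mem_support j)
  rcases Nat.eq_zero_or_pos i with rfl | hi0
  · rw [Walk.getVert_zero] at hxy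
    have := hp.2 _ _ _ (hp.1.cons (h := hxy.symm) hy)
    simp at this
  rcases hi.eq_or_lt with rfl | hil
  · rw [Walk.getVert_length] at hxy
    have := hp.2 _ _ _ (hp.1.concat hy hxy)
    simp at this
  have h1 : G.Adj (p.getVert i) (p.getVert (i + 1)) := p.adj_getVert_succ hil
  have h2 : G.Adj (p.getVert (i - 1)) (p.getVert i) := by
    have := p.adj_getVert_succ (i := i - 1) (by omega)
    rwa [Nat.sub_add_cancel hi0] at this
  rcases hdeg _ _ _ _ h1 h2.symm hxy with h | h | h
  · have := hp.1.getVert_injOn (by simp; omega) (by simp; omega) h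
    omega
  · exact hmem _ h
  · exact hmem _ h

/-- A finite tree without three distinct neighbours at a common vertex is a path. -/
lemma IsTree.exists_iso_pathGraph [Finite V] (hG : G.IsTree)
    (hdeg : ∀ v a b c, G.Adj v a → G.Adj v b → G.Adj v c → a = b ∨ a = c ∨ b = c) :
    ∃ n : ℕ, Nonempty (G ≃g pathGraph (n + 1)) := by
  classical
  have := hG.connected.nonempty
  obtain ⟨u, v, p, hp, hmax⟩ := Walk.exists_isPath_forall_isPath_length_le_length G
  have hmem := hG.connected.mem_support_of_isLongestPath hdeg (p := p) ⟨hp, fun _ _ => hmax _ _⟩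
  have htop : p.toSubgraph = ⊤ := by
    ext a b
    · simp [hmem a]
    · rw [← Subgraph.mem_edgeSet, Walk.mem_edges_toSubgraph]
      exact ⟨fun h => p.adj_of_mem_edges h,
        fun h => hG.isAcyclic.mem_edges_of_adj hp h (hmem a) (hmem b)⟩
  have e := hp.pathGraphIsoToSubgraph
  rw [htop] at e
  exact ⟨p.length, ⟨(e.trans Subgraph.topIso).symm⟩⟩

/-- A finite acyclic graph without three distinct neighbours at a common vertex is a linear
forest. -/
lemma IsAcyclic.isLinearForest [Finite V] (hG : G.IsAcyclic)
    (hdeg : ∀ v a b c, G.Adj v a → G.Adj v b → G.Adj v c → a = b ∨ a = c ∨ b = c) :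
    G.IsLinearForest := by
  refine ⟨hG, fun c => (hG.isTree_connectedComponent c).exists_iso_pathGraph ?_⟩
  intro v x y z hx hy hz
  simpa only [Subtype.ext_iff] using hdeg v x y z hx hy hz

end LinearForest

/-! ### Gallai number one and passing through a cut vertex -/

section Gallai

variable {V : Type*} {G : SimpleGraph V}

/-- A longest path missing each single vertex rules out Gallai number one. -/
lemma lpt_ne_one (h : ∀ w, ∃ (u v : V) (p : G.Walk u v), G.IsLongestPath p ∧ w ∉ p.support) :
    G.lpt ≠ 1 := by
  intro h1
  -- As `sInf ∅ = 0`, the value one already forces some finite Gallai set to exist.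
  have hne : {n : ℕ | ∃ S : Finset V, G.IsGallaiSet (S : Set V) ∧ S.card = n}.Nonempty := by
    by_contra hn
    rw [Set.not_nonempty_iff_eq_empty] at hn
    rw [lpt, hn, Nat.sInf_empty] at h1
    exact zero_ne_one h1
  obtain ⟨S, hS, hcard⟩ := Nat.sInf_mem hne
  rw [← lpt, h1, Finset.card_eq_one] at hcard
  obtain ⟨w, rfl⟩ := hcard
  obtain ⟨u, v, p, hp, hw⟩ := h w
  obtain ⟨x, hx, hxp⟩ := hS u v p hp
  rw [Finset.mem_coe, Finset.mem_singleton] at hx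
  exact hw (hx ▸ hxp)

/-- A fixer is an induced subgraph of every finite connected graph whose Gallai number is not
one. -/
lemma IsFixer.isIndContained {H : SimpleGraph V} (hH : H.IsFixer) {W : Type} [Finite W]
    {G : SimpleGraph W} (hG : G.Connected) (hlpt : G.lpt ≠ 1) : H.IsIndContained G :=
  by_contra fun h => hlpt (hH W G h hG)

/-- If all edges leaving `A` end in the single vertex `b`, then a path with both ends outside `A`
does not meet `A`. -/
lemma Walk.IsPath.notMem_of_mem_support {A : Set V} {b : V}
    (hA : ∀ x y, G.Adj x y → x ∈ A → y ∉ A → y = b) {u v : V} {p : G.Walk u v} (hp : p.IsPath)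
    (hu : u ∉ A) (hv : v ∉ A) {w : V} (hw : w ∈ p.support) : w ∉ A := by
  classical
  intro hwA
  -- The path enters `A` before `w` and leaves it after `w`, each time through `b`, so it would
  -- visit `b` twice.
  obtain ⟨d, hd, hd1, hd2⟩ := (p.takeUntil w hw).exists_boundary_dart Aᶜ hu (by simpa using hwA)
  obtain ⟨e, he, he1, he2⟩ := (p.dropUntil w hw).exists_boundary_dart A hwA hv
  have hdb := hA _ _ d.adj.symm (by simpa using hd2) hd1
  have heb := hA _ _ e.adj he1 he2
  have h1 : b ∈ (p.takeUntil w hw).support := hdb ▸ Walk.dart_fst_mem_support_of_mem_darts _ hd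
  have h2 : b ∈ (p.dropUntil w hw).support := heb ▸ Walk.dart_snd_mem_support_of_mem_darts _ he
  have hbw : b ≠ w := fun h => hd1 (by rw [hdb, h]; exact hwA)
  rw [← p.take_spec hw] at hp
  exact hp.ne_of_mem_support_of_append hbw h1 h2 rfl

end Gallai

/-! ### Exhaustive path search in cubic neighbour tables -/

section TableGraph

/-- The `i`-th digit in base `64` of `c`. -/
def digit64 (c i : ℕ) : ℕ := Nat.land (Nat.shiftRight c (Nat.mul 6 i)) 63

/-- The number with the given digits in base `64`, the least significant one first. -/
def ofDigits64 (l : List ℕ) : ℕ := l.foldr (fun a c => Nat.add a (Nat.mul 64 c)) 0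

/-- The neighbours of `v` in the neighbour table encoded by `c`, which lists three neighbours of
each vertex, padded with the vertex itself. -/
def tableNeighbors (c v : ℕ) : List ℕ :=
  [digit64 c (Nat.mul 3 v), digit64 c (Nat.add (Nat.mul 3 v) 1),
    digit64 c (Nat.add (Nat.mul 3 v) 2)]

/-- The graph on `Fin n` with the neighbour table encoded by `c`. -/
def tableGraph (n c : ℕ) : SimpleGraph (Fin n) where
  Adj a b := a ≠ b ∧ b.val ∈ tableNeighbors c a ∧ a.val ∈ tableNeighbors c b
  symm := ⟨fun _ _ h => ⟨h.1.symm, h.2.2, h.2.1⟩⟩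
  loopless := ⟨fun _ h => h.1 rfl⟩

instance (n c : ℕ) : DecidableRel (tableGraph n c).Adj := fun a b =>
  inferInstanceAs (Decidable (a ≠ b ∧ b.val ∈ tableNeighbors c a ∧ a.val ∈ tableNeighbors c b))

/-- Depth-first search: whether `good` holds of the length and the end of all paths that extend a
path of length `d` with end `v` and set of vertices `s` (a bit mask) by at most `k` edges. -/
def explore (c : ℕ) (good : ℕ → ℕ → Bool) (k : ℕ) : ℕ → ℕ → ℕ → Bool :=
  -- Bare recursors and `Nat` operations keep kernel evaluation fast. The first branch of `Bool.rec`
  -- is the `false` case.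
  Nat.rec (fun d _ v => good d v)
    (fun _ ih d s v => Bool.rec false
      ((tableNeighbors c v).rec true fun w _ t =>
        Bool.rec false t (Bool.rec (ih (Nat.succ d) (Nat.lor s (Nat.shiftLeft 1 w)) w) true
          (Nat.beq (Nat.land (Nat.shiftRight s w) 1) 1))) (good d v)) k

lemma explore_succ (c : ℕ) (good : ℕ → ℕ → Bool) (k d s v : ℕ) :
    explore c good (k + 1) d s v = true ↔ good d v = true ∧ ∀ w ∈ tableNeighbors c v,
      s.testBit w = true ∨ explore c good k (d + 1) (s ||| 1 <<< w) w = true := by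
  have key (w : ℕ) (t e : Bool) :
      (Bool.rec false t (Bool.rec e true (Nat.beq (Nat.land (Nat.shiftRight s w) 1) 1)) : Bool)
        = true ↔ (s.testBit w = true ∨ e = true) ∧ t = true := by
    have : Nat.beq (Nat.land (Nat.shiftRight s w) 1) 1 = s.testBit w := by
      rw [Nat.testBit_eq_decide_div_mod_eq, ← Nat.shiftRight_eq_div_pow]
      change Nat.beq ((s >>> w) &&& 1) 1 = _
      rw [Nat.and_one_is_mod, Bool.eq_iff_iff, Nat.beq_eq, decide_eq_true_iff]
    rw [this]
    cases s.testBit w <;> cases e <;> cases t <;> simp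
  change (Bool.rec false _ (good d v) : Bool) = true ↔ _
  cases good d v
  · simp
  · simp only [true_and]
    induction tableNeighbors c v with
    | nil => simp
    | cons w l ih =>
      rw [List.forall_mem_cons, ← ih]
      exact key _ _ _

/-- The mask `s` only has to spare the vertices still to be visited; it contains the current vertex
in practice, hence the `tail`. -/
lemma explore_sound {n c : ℕ} {good : ℕ → ℕ → Bool} {k d s : ℕ} {v x : Fin n}
    (h : explore c good k d s v = true) (p : (tableGraph n c).Walk v x) (hp : p.IsPath)
    (hk : p.length ≤ k) (hs : ∀ w ∈ p.support.tail, s.testBit w = false) :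
    good (d + p.length) x = true := by
  induction p generalizing k d s with
  | nil =>
    cases k with
    | zero => exact h
    | succ k => exact ((explore_succ ..).mp h).1
  | @cons v w x hvw p ih =>
    rw [Walk.cons_isPath_iff] at hp
    rw [Walk.length_cons] at hk ⊢
    rw [Walk.support_cons, List.tail_cons] at hs
    cases k with
    | zero => omega
    | succ k =>
      rcases ((explore_succ ..).mp h).2 w hvw.2.1 with h' | h'
      · rw [hs w p.start_mem_support] at h'
        exact absurd h' Bool.false_ne_true
      · have := ih h' hp.1 (by omega) fun y hy => by
          have hne : (w : ℕ) ≠ y := by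
            intro hwy
            have hnd := hp.1.support_nodup
            rw [← Walk.cons_tail_support, List.nodup_cons] at hnd
            exact hnd.1 (Fin.ext hwy ▸ hy)
          rw [Nat.testBit_or, hs y (List.mem_of_mem_tail hy), Nat.one_shiftLeft,
            Nat.testBit_two_pow_of_ne hne, Bool.or_false]
        rwa [Nat.add_right_comm, Nat.add_assoc] at this

/-- All paths from `v` of length at most `k` satisfy a predicate of their length and end that the
depth-first search verifies. -/
lemma explore_sound_start {n c : ℕ} {good : ℕ → ℕ → Bool} {k : ℕ} {v x : Fin n}
    (h : explore c good k 0 (Nat.shiftLeft 1 v) v = true) (p : (tableGraph n c).Walk v x)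
    (hp : p.IsPath) (hk : p.length ≤ k) : good p.length x = true := by
  have := explore_sound h p hp hk fun w hw => by
    have hne : (v : ℕ) ≠ w := by
      intro hvw
      have hnd := hp.support_nodup
      rw [← Walk.cons_tail_support, List.nodup_cons] at hnd
      exact hnd.1 (Fin.ext hvw ▸ hw)
    change (1 <<< (v : ℕ)).testBit w = false
    rw [Nat.one_shiftLeft, Nat.testBit_two_pow_of_ne hne]
  rwa [Nat.zero_add] at this

/-- A graph on `Fin n` in which each non-zero vertex has a smaller neighbour is connected. -/
lemma connected_of_exists_adj_lt {n : ℕ} {G : SimpleGraph (Fin (n + 1))}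
    (h : ∀ v ≠ 0, ∃ w < v, G.Adj v w) : G.Connected := by
  refine connected_iff_exists_forall_reachable _ |>.mpr ⟨0, fun v => ?_⟩
  induction v using WellFoundedLT.induction with
  | ind v ih =>
    by_cases hv : v = 0
    · rw [hv]
    · obtain ⟨w, hw, hvw⟩ := h v hv
      exact (ih w hw).trans hvw.symm.reachable

/-- If all paths have at most `m + 1` vertices and each vertex is missed by one of the given paths
on `m + 1` vertices, then the Gallai number is not one. -/
lemma lpt_ne_one_of_lists {V : Type*} {G : SimpleGraph V} {m : ℕ}
    (hm : ∀ (u v : V) (p : G.Walk u v), p.IsPath → p.length ≤ m) (L : List (List V))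
    (hL : ∀ l ∈ L, l.IsChain G.Adj ∧ l.Nodup ∧ l.length = m + 1) (hw : ∀ w, ∃ l ∈ L, w ∉ l) :
    G.lpt ≠ 1 := by
  refine lpt_ne_one fun w => ?_
  obtain ⟨l, hl, hwl⟩ := hw w
  obtain ⟨hc, hnd, hlen⟩ := hL l hl
  have hne : l ≠ [] := List.ne_nil_of_length_eq_add_one hlen
  refine ⟨_, _, Walk.ofSupport l hne hc, ⟨?_, fun u v q hq => ?_⟩, ?_⟩
  · rwa [Walk.isPath_def, Walk.support_ofSupport]
  · rw [Walk.length_ofSupport, hlen]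
    exact hm u v q hq
  · rwa [Walk.support_ofSupport]

end TableGraph

/-! ### The first obstruction: the split Petersen graph -/

section Petersen

/-- The neighbour table of `splitPetersen`. -/
def splitPetersenTable : ℕ := ofDigits64
  [1, 2, 9, 0, 3, 4, 0, 5, 6, 1, 5, 7, 1, 6, 8, 2, 3, 8, 2, 4, 7, 3, 6, 10, 4, 5, 11, 0, 9, 9, 7,
   10, 10, 8, 11, 11]

/-- The Petersen graph with one vertex replaced by three leaves, `9`, `10` and `11`. -/
abbrev splitPetersen : SimpleGraph (Fin 12) := tableGraph 12 splitPetersenTable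

/-- Longest paths of `splitPetersen` without a common vertex. -/
def splitPetersenPaths : List (List (Fin 12)) :=
  [[1, 0, 2, 5, 3, 7, 6, 4, 8, 11],
   [9, 0, 1, 3, 5, 8, 4, 6, 7, 10],
   [9, 0, 1, 3, 5, 2, 6, 4, 8, 11],
   [9, 0, 1, 3, 7, 6, 2, 5, 8, 11],
   [9, 0, 1, 4, 6, 2, 5, 3, 7, 10],
   [9, 0, 1, 4, 8, 5, 2, 6, 7, 10],
   [9, 0, 2, 5, 3, 7, 6, 4, 8, 11],
   [9, 0, 2, 5, 8, 4, 1, 3, 7, 10],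
   [9, 0, 2, 6, 7, 3, 1, 4, 8, 11],
   [10, 7, 3, 1, 4, 6, 2, 5, 8, 11]]

lemma splitPetersen_connected : splitPetersen.Connected :=
  connected_of_exists_adj_lt (by decide +kernel)

lemma splitPetersen_lpt : splitPetersen.lpt ≠ 1 := by
  have hb : ∀ v : Fin 12, explore splitPetersenTable (fun d _ => Nat.ble d 9) 11 0
      (Nat.shiftLeft 1 v) v = true := by decide +kernel
  refine lpt_ne_one_of_lists (m := 9) (fun u v p hp => ?_) splitPetersenPaths
    (by decide +kernel) (by decide +kernel)
  have hlt := hp.length_lt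
  rw [Fintype.card_fin] at hlt
  exact Nat.le_of_ble_eq_true (explore_sound_start (hb u) p hp (by omega))

/-- The cycles of `splitPetersen` have lengths between four and nine. -/
lemma splitPetersen_length_of_adj {v w : Fin 12} (hvw : splitPetersen.Adj v w)
    {p : splitPetersen.Walk w v} (hp : p.IsPath) : p.length ≠ 2 ∧ p.length ≤ 8 := by
  -- A path of length `d ≥ 2` between adjacent vertices closes to a cycle of length `d + 1`; `d = 1`
  -- is the edge itself.
  have hb : ∀ w : Fin 12, explore splitPetersenTable
      (fun d x => decide (x ∈ tableNeighbors splitPetersenTable w → d ≠ 2 ∧ d ≤ 8)) 11 0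
      (Nat.shiftLeft 1 w) w = true := by decide +kernel
  have hlt := hp.length_lt
  rw [Fintype.card_fin] at hlt
  exact of_decide_eq_true (explore_sound_start (hb w) p hp (by omega)) hvw.2.2

/-- Each graph obtained from `splitPetersen` by deleting at most two vertices has a vertex with
three neighbours. -/
lemma splitPetersen_exists_three_adj (x y : Fin 12) : ∃ v a b c : Fin 12,
    (splitPetersen.Adj v a ∧ splitPetersen.Adj v b ∧ splitPetersen.Adj v c) ∧
    (a ≠ b ∧ a ≠ c ∧ b ≠ c) ∧ ∀ z ∈ [v, a, b, c], z ≠ x ∧ z ≠ y := by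
  -- Quantifying over a singleton list names the neighbour list while keeping the statement
  -- decidable.
  have h : ∀ x y : Fin 12, ∃ v : Fin 12, ∃ l ∈ [(tableNeighbors splitPetersenTable v).map
      (Fin.ofNat 12)], (∀ a ∈ l, splitPetersen.Adj v a) ∧ l.Nodup ∧ l.length = 3 ∧
      ∀ z ∈ v :: l, z ≠ x ∧ z ≠ y := by decide +kernel
  obtain ⟨v, l, -, hadj, hnd, hlen, hz⟩ := h x y
  obtain ⟨a, b, c, rfl⟩ := List.length_eq_three.mp hlen
  rw [List.forall_mem_cons, List.forall_mem_cons, List.forall_mem_cons] at hadj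
  simp only [List.nodup_cons, List.mem_cons, not_or] at hnd
  exact ⟨v, a, b, c, ⟨hadj.1, hadj.2.1, hadj.2.2.1⟩, ⟨hnd.1.1, hnd.1.2.1, hnd.2.1.1⟩, hz⟩

end Petersen

/-! ### The second obstruction: a claw-free inflation -/

section InflatedPetersen

/-- The neighbour table of `inflatedPetersen`. -/
def inflatedPetersenTable : ℕ := ofDigits64
  [1, 2, 27, 0, 2, 3, 0, 1, 4, 1, 5, 6, 2, 7, 8, 3, 6, 9, 3, 5, 10, 4, 8, 11, 4, 7, 12, 5, 13, 14,
   6, 15, 16, 7, 17, 18, 8, 19, 20, 9, 14, 21, 9, 13, 17, 10, 16, 22, 10, 15, 20, 11, 14, 18, 11,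
   17, 23, 12, 20, 24, 12, 16, 19, 13, 24, 25, 15, 23, 26, 18, 22, 26, 19, 21, 25, 21, 24, 30, 22,
   23, 33, 0, 28, 27, 27, 29, 28, 28, 29, 29, 25, 31, 30, 30, 32, 31, 31, 32, 32, 26, 34, 33, 33,
   35, 34, 34, 35, 35]

/-- The graph `splitPetersen` with each vertex of degree three replaced by a triangle and each leaf
replaced by a path on three vertices; the vertices of these paths are those from `27` on. -/
abbrev inflatedPetersen : SimpleGraph (Fin 36) := tableGraph 36 inflatedPetersenTable

/-- Longest paths of `inflatedPetersen` without a common vertex. -/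
def inflatedPetersenPaths : List (List (Fin 36)) :=
  [[29, 28, 27, 0, 1, 2, 4, 7, 8, 12, 19, 20, 16, 10, 15, 22, 26, 23, 18, 11, 17, 14, 9, 13, 21,
    24, 25, 30, 31, 32],
   [29, 28, 27, 0, 1, 2, 4, 7, 8, 12, 19, 20, 16, 15, 10, 6, 3, 5, 9, 13, 14, 17, 11, 18, 23, 22,
    26, 33, 34, 35],
   [32, 31, 30, 25, 21, 24, 19, 12, 20, 16, 15, 10, 6, 5, 3, 1, 0, 2, 4, 8, 7, 11, 17, 18, 23, 22,
    26, 33, 34, 35],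
   [29, 28, 27, 0, 1, 2, 4, 7, 8, 12, 20, 19, 24, 25, 21, 13, 14, 9, 5, 3, 6, 10, 16, 15, 22, 23,
    26, 33, 34, 35],
   [29, 28, 27, 0, 1, 2, 4, 8, 7, 11, 17, 18, 23, 26, 22, 15, 16, 10, 6, 3, 5, 9, 14, 13, 21, 24,
    25, 30, 31, 32],
   [29, 28, 27, 0, 1, 2, 4, 8, 7, 11, 18, 17, 14, 13, 9, 5, 3, 6, 10, 15, 16, 20, 12, 19, 24, 21,
    25, 30, 31, 32],
   [29, 28, 27, 0, 2, 1, 3, 5, 6, 10, 15, 16, 20, 12, 19, 24, 25, 21, 13, 9, 14, 17, 11, 18, 23,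
    22, 26, 33, 34, 35],
   [29, 28, 27, 0, 2, 1, 3, 6, 5, 9, 14, 13, 21, 25, 24, 19, 20, 12, 8, 4, 7, 11, 17, 18, 23, 22,
    26, 33, 34, 35],
   [32, 31, 30, 25, 21, 24, 19, 20, 12, 8, 4, 7, 11, 18, 17, 14, 13, 9, 5, 3, 6, 10, 16, 15, 22,
    23, 26, 33, 34, 35]]

lemma inflatedPetersen_connected : inflatedPetersen.Connected :=
  connected_of_exists_adj_lt (by decide +kernel)

/-- A path of `inflatedPetersen` with no end on a pendant path avoids the pendant paths. -/
lemma inflatedPetersen_lt_of_mem_support {u v : Fin 36} {p : inflatedPetersen.Walk u v}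
    (hp : p.IsPath) (hu : u < 27) (hv : v < 27) {w : Fin 36} (hw : w ∈ p.support) : w < 27 := by
  by_contra hlt
  -- The quotients by 3 equal to 9, 10 and 11 label the pendant paths, attached at 0, 25 and 26
  -- respectively.
  have h : ∀ w : Fin 36, ¬ w < 27 → ∃ b ∈ ([0, 25, 26] : List (Fin 36)), ∀ x : Fin 36,
      x.val / 3 = w.val / 3 → ∀ y : Fin 36, y.val / 3 ≠ w.val / 3 → inflatedPetersen.Adj x y →
      y = b := by decide +kernel
  obtain ⟨b, -, hb⟩ := h w hlt
  refine hp.notMem_of_mem_support (A := {x : Fin 36 | x.val / 3 = w.val / 3})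
    (fun x y hxy hx hy => hb x hx y hy hxy) ?_ ?_ hw (Set.mem_ofPred_eq .. ▸ rfl) <;>
    simp only [Set.mem_ofPred_eq] <;> omega

/-- A path of `inflatedPetersen` from `u` on a pendant path to a vertex further outwards stays
there. -/
lemma inflatedPetersen_lt_of_succ_mem_support {u v w : Fin 36} {p : inflatedPetersen.Walk u v}
    (hp : p.IsPath) (hu : 27 ≤ u) (hw : w ∈ p.support) (hwu : w.val / 3 = u.val / 3)
    (hlt : u < w) : u < v := by
  by_contra hv
  have h : ∀ u : Fin 36, 27 ≤ u → ∀ x : Fin 36, x.val / 3 = u.val / 3 ∧ u < x →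
      ∀ y : Fin 36, ¬ (y.val / 3 = u.val / 3 ∧ u < y) → inflatedPetersen.Adj x y → y = u := by
    decide +kernel
  exact hp.notMem_of_mem_support (A := {x : Fin 36 | x.val / 3 = u.val / 3 ∧ u < x})
    (fun x y hxy hx hy => h u hu x hx y hy hxy) (fun h => h.2.false) (fun h => hv h.2) hw
    ⟨hwu, hlt⟩

-- Searching from the three leaves is enough: other paths with an end on a pendant path reduce to
-- these, and the rest lie among 27 vertices.
set_option maxHeartbeats 0 in
lemma explore_inflatedPetersen : ∀ v ∈ ([29, 32, 35] : List (Fin 36)),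
    explore inflatedPetersenTable (fun d _ => Nat.ble d 29) 35 0 (Nat.shiftLeft 1 v) v = true := by
  decide +kernel

/-- Induction outwards to the leaf. If the next outer vertex is not on the path, prepend it; if it
is, the other end lies further out, so reverse the path. -/
lemma inflatedPetersen_length_le_of_le {u v : Fin 36} (hu : 27 ≤ u)
    (p : inflatedPetersen.Walk u v) (hp : p.IsPath) : p.length ≤ 29 := by
  induction u using WellFoundedGT.induction generalizing v with
  | ind u ih =>
    have h : ∀ u : Fin 36, 27 ≤ u → u ∈ ([29, 32, 35] : List (Fin 36)) ∨
        ∃ w, u < w ∧ w.val / 3 = u.val / 3 ∧ inflatedPetersen.Adj u w := by decide +kernel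
    rcases h u hu with hleaf | ⟨w, huw, hdiv, hadj⟩
    · have hlt := hp.length_lt
      rw [Fintype.card_fin] at hlt
      exact Nat.le_of_ble_eq_true
        (explore_sound_start (explore_inflatedPetersen u hleaf) p hp (by omega))
    · by_cases hw : w ∈ p.support
      · have hlt := inflatedPetersen_lt_of_succ_mem_support hp hu hw hdiv huw
        rw [← p.length_reverse]
        exact ih v hlt (hu.trans hlt.le) p.reverse hp.reverse
      · have := ih w huw (hu.trans huw.le) (p.cons hadj.symm) (hp.cons hw)
        rw [Walk.length_cons] at this
        omega

lemma inflatedPetersen_length_le {u v : Fin 36} {p : inflatedPetersen.Walk u v}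
    (hp : p.IsPath) : p.length ≤ 29 := by
  by_cases hu : 27 ≤ u
  · exact inflatedPetersen_length_le_of_le hu p hp
  by_cases hv : 27 ≤ v
  · rw [← p.length_reverse]
    exact inflatedPetersen_length_le_of_le hv p.reverse hp.reverse
  have hsub : p.support.toFinset ⊆ Finset.Iio 27 := fun w hw => Finset.mem_Iio.mpr
    (inflatedPetersen_lt_of_mem_support hp (not_le.mp hu) (not_le.mp hv) (List.mem_toFinset.mp hw))
  have hcard := Finset.card_le_card hsub
  rw [List.toFinset_card_of_nodup hp.support_nodup, p.length_support, Fin.card_Iio] at hcard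
  change _ ≤ 27 at hcard
  omega

lemma inflatedPetersen_lpt : inflatedPetersen.lpt ≠ 1 :=
  lpt_ne_one_of_lists (m := 29) (fun _ _ _ => inflatedPetersen_length_le) inflatedPetersenPaths
    (by decide +kernel) (by decide +kernel)

/-- The cycles of `inflatedPetersen` of length at most nine are triangles. -/
lemma inflatedPetersen_length_of_adj {v w : Fin 36} (hvw : inflatedPetersen.Adj v w)
    {p : inflatedPetersen.Walk w v} (hp : p.IsPath) (h8 : p.length ≤ 8) : p.length ≤ 2 := by
  have hb : ∀ w : Fin 36, explore inflatedPetersenTable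
      (fun d x => decide (x ∈ tableNeighbors inflatedPetersenTable w → d ≤ 2)) 8 0
      (Nat.shiftLeft 1 w) w = true := by decide +kernel
  exact of_decide_eq_true (explore_sound_start (hb w) p hp h8) hvw.2.2

/-- The graph `inflatedPetersen` is claw-free. -/
lemma inflatedPetersen_adj_of_adj {v a b c : Fin 36} (ha : inflatedPetersen.Adj v a)
    (hb : inflatedPetersen.Adj v b) (hc : inflatedPetersen.Adj v c) (hab : a ≠ b) (hac : a ≠ c)
    (hbc : b ≠ c) :
    inflatedPetersen.Adj a b ∨ inflatedPetersen.Adj a c ∨ inflatedPetersen.Adj b c := by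
  -- Ranging over table entries leaves 27 triples per vertex to check.
  have h : ∀ v : Fin 36, ∀ a ∈ tableNeighbors inflatedPetersenTable v,
      ∀ b ∈ tableNeighbors inflatedPetersenTable v, ∀ c ∈ tableNeighbors inflatedPetersenTable v,
      a ≠ b → a ≠ c → b ≠ c → a ≠ v → b ≠ v → c ≠ v →
      inflatedPetersen.Adj (Fin.ofNat 36 a) (Fin.ofNat 36 b) ∨
      inflatedPetersen.Adj (Fin.ofNat 36 a) (Fin.ofNat 36 c) ∨
      inflatedPetersen.Adj (Fin.ofNat 36 b) (Fin.ofNat 36 c) := by decide +kernel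
  have := h v a ha.2.1 b hb.2.1 c hc.2.1 (Fin.val_ne_of_ne hab) (Fin.val_ne_of_ne hac)
    (Fin.val_ne_of_ne hbc) (Fin.val_ne_of_ne ha.1.symm) (Fin.val_ne_of_ne hb.1.symm)
    (Fin.val_ne_of_ne hc.1.symm)
  simpa only [Fin.ofNat_eq_cast, Fin.cast_val_eq_self] using this

end InflatedPetersen

/-! ### Consequences for fixers -/

section Fixer

variable {V : Type*} {H : SimpleGraph V}

/-- A cycle minus an edge is a path of length at least 2. Its image in `splitPetersen` has length at
most 8 and not 2, but then its image in `inflatedPetersen` has length at most 2. -/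
lemma IsFixer.isAcyclic (hH : H.IsFixer) : H.IsAcyclic := by
  obtain ⟨f⟩ := hH.isIndContained splitPetersen_connected splitPetersen_lpt
  obtain ⟨g⟩ := hH.isIndContained inflatedPetersen_connected inflatedPetersen_lpt
  intro v c hc
  cases c with
  | nil => exact Walk.not_isCycle_nil hc
  | cons h p =>
    have h3 := hc.three_le_length
    have hp := ((Walk.cons_isCycle_iff _ _).mp hc).1
    have hf := splitPetersen_length_of_adj (f.map_adj_iff.mpr h)
      (hp.map f.injective : (p.map f.toHom).IsPath)
    rw [Walk.length_map] at hf
    have hg := inflatedPetersen_length_of_adj (g.map_adj_iff.mpr h)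
      (hp.map g.injective : (p.map g.toHom).IsPath)
    rw [Walk.length_map] at hg
    rw [Walk.length_cons] at h3
    have := hg hf.2
    omega

/-- In a fixer, no vertex has three distinct neighbours. -/
lemma IsFixer.eq_of_adj (hH : H.IsFixer) (v a b c : V) (ha : H.Adj v a) (hb : H.Adj v b)
    (hc : H.Adj v c) : a = b ∨ a = c ∨ b = c := by
  obtain ⟨g⟩ := hH.isIndContained inflatedPetersen_connected inflatedPetersen_lpt
  have triangle {x y : V} (hx : H.Adj v x) (hy : H.Adj v y) (hxy : H.Adj x y) : False := by
    refine hH.isAcyclic (Walk.cons hx (Walk.cons hxy (Walk.cons hy.symm Walk.nil))) ?_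
    simp [Walk.cons_isCycle_iff, hx.ne, hy.ne, hxy.ne, hx.ne', hy.ne']
  by_contra! hne
  rcases inflatedPetersen_adj_of_adj (g.map_adj_iff.mpr ha) (g.map_adj_iff.mpr hb)
    (g.map_adj_iff.mpr hc) (g.injective.ne hne.1) (g.injective.ne hne.2.1)
    (g.injective.ne hne.2.2) with h | h | h
  · exact triangle ha hb (g.map_adj_iff.mp h)
  · exact triangle ha hc (g.map_adj_iff.mp h)
  · exact triangle hb hc (g.map_adj_iff.mp h)

lemma IsFixer.card_le_nine [Finite V] (hH : H.IsFixer) : Nat.card V ≤ 9 := by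
  classical
  have := Fintype.ofFinite V
  obtain ⟨f⟩ := hH.isIndContained splitPetersen_connected splitPetersen_lpt
  by_contra! hcard
  rw [Nat.card_eq_fintype_card] at hcard
  have hcompl : ((Finset.univ.map f.toEmbedding)ᶜ).card ≤ 2 := by
    rw [Finset.card_compl, Finset.card_map, Finset.card_univ, Fintype.card_fin]
    omega
  obtain ⟨x, y, hxy⟩ : ∃ x y, ∀ z, z ≠ x ∧ z ≠ y → ∃ t, f t = z := by
    -- Pad the set of missed vertices to exactly two elements.
    obtain ⟨T, hsub, hT⟩ := Finset.exists_superset_card_eq hcompl (by simp)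
    obtain ⟨x, y, -, rfl⟩ := Finset.card_eq_two.mp hT
    refine ⟨x, y, fun z hz => ?_⟩
    by_contra! hn
    have : z ∈ ({x, y} : Finset (Fin 12)) := hsub (by simpa using hn)
    simp [hz.1, hz.2] at this
  obtain ⟨v, a, b, c, ⟨ha, hb, hc⟩, ⟨hab, hac, hbc⟩, hz⟩ := splitPetersen_exists_three_adj x y
  simp only [List.forall_mem_cons] at hz
  obtain ⟨v, rfl⟩ := hxy v hz.1
  obtain ⟨a, rfl⟩ := hxy a hz.2.1
  obtain ⟨b, rfl⟩ := hxy b hz.2.2.1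
  obtain ⟨c, rfl⟩ := hxy c hz.2.2.2.1
  rcases hH.eq_of_adj v a b c (f.map_adj_iff.mp ha) (f.map_adj_iff.mp hb) (f.map_adj_iff.mp hc)
    with rfl | rfl | rfl
  · exact hab rfl
  · exact hac rfl
  · exact hbc rfl

end Fixer

end SimpleGraph

theorem proposition5 {V : Type*} [Finite V] (H : SimpleGraph V) (hH : H.IsFixer) :
    H.IsLinearForest ∧ Nat.card V ≤ 9 :=
  ⟨hH.isAcyclic.isLinearForest hH.eq_of_adj, hH.card_le_nine⟩
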